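/- Let $X\subset\mathbb R^d$ satisfy $\overline X=\overline{\operatorname{int}X}$ and let $\mathcal H$ be a real reproducing kernel Hilbert space on $X$ whose kernel $k$ is of class $C^2(X\times X)$ (continuous on $X\times X$, $C^2$ in the interior, with derivatives up to order $2$ extending continuously to $X\times X$; partial derivatives at boundary points of $X$ are the limits from the interior). Write $k_x=k(x,\cdot)$ and $(\partial_a k)_x=\partial k(s,\cdot)/\partial s^a|_{s=x}\in\mathcal H$. Let $x_1,\dots,x_n\in X$, $y=(y_1,\dots,y_n)\in\mathbb R^n$, and equip $\mathbb R^n$ with $\langle u,v\rangle_n=\frac1n\sum_i u_iv_i$. Define bounded operators $S:\mathcal H\to\mathbb R^n$, $(Sf)_i=f(x_i)$, and $\nabla:\mathcal H\to(\mathbb R^n)^d$, $(\nabla f)_{a,i}=\langle f,(\partial_a k)_{x_i}\rangle_{\mathcal H}$, with adjoints $S^*,\nabla^*$. Put $$\Omega(f)=\sum_{a=1}^d\Big(\frac1n\sum_{i=1}^n\Big(\frac{\partial f}{\partial x^a}(x_i)\Big)^2\Big)^{1/2},\qquad \mathcal E(f)=\frac1n\sum_{i=1}^n(y_i-f(x_i))^2+\tau\big(2\,\Omega(f)+\nu\|f\|_{\mathcal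 H}^2\big),$$ with $\tau>0$, $\nu\ge0$. Let $\sigma,\eta>0$ with $\sigma\ge\|S^*S\|+\tau\nu$ and $\eta\ge\|\nabla\nabla^*\|$, let $l>3/2$, and let $\varepsilon^t=O(t^{-l})$ (in particular, any $\varepsilon^t\sim t^{-l}$). Let $f^0,f^1\in\mathcal H$ and $s_1\ge1$ be arbitrary and, for $t=2,3,\dots$, let $$s_t=\tfrac12\Big(1+\sqrt{1+4s_{t-1}^2}\Big),\qquad \tilde f^t=\Big(1+\frac{s_{t-1}-1}{s_t}\Big)f^{t-1}+\frac{1-s_{t-1}}{s_t}f^{t-2},$$ $$g^t=\Big(1-\frac{\tau\nu}{\sigma}\Big)\tilde f^t-\frac1\sigma S^*(S\tilde f^t-y),\qquad f^t=g^t-\nabla^*\bar v^t.$$ Here $\bar v^t=v^q$ for some $q\ge1$, where, from an arbitrary $v^0\in(\mathbb R^n)^d$ (which may depend on $t$), $$v^{q}=\pi\Big(v^{q-1}-\frac1\eta\nabla(\nabla^*v^{q-1}-g^t)\Big),$$ $\pi$ being the metric projection onto $\{v\in(\mathbb R^n)^d:\|v_a\|_n\le\tau/\sigma,\ a=1,\dots,d\}$,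 and $q$ is such that $$\frac{2\tau}{\sigma}\Omega(f^t)-2\langle\nabla^*\bar v^t,f^t\rangle_{\mathcal H}\le(\varepsilon^t)^2 .$$ Then $\mathcal E$ has a minimizer, and there is a constant $C>0$ such that for every minimizer $\hat f$ of $\mathcal E$ and every $t\ge1$ $$\mathcal E(f^t)-\mathcal E(\hat f)\le\frac{C}{t^2},\qquad\text{and, if }\nu>0,\qquad \|f^t-\hat f\|_{\mathcal H}\le\frac2t\sqrt{\frac{C}{\nu\tau}} .$$ -/

import Mathlib

open Filter Topology Asymptotics

noncomputable section

namespace DerivReg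

/-! ### The space `ℝⁿ` with the inner product normalized by `1/n` -/

/-- `ℝⁿ`, to be equipped with `⟨u, v⟩ = (1/n) ∑ᵢ uᵢ vᵢ`. -/
def EmpVec (n : ℕ) : Type := Fin n → ℝ

instance (n : ℕ) : AddCommGroup (EmpVec n) := inferInstanceAs (AddCommGroup (Fin n → ℝ))

instance (n : ℕ) : Module ℝ (EmpVec n) := inferInstanceAs (Module ℝ (Fin n → ℝ))

instance (n : ℕ) : FiniteDimensional ℝ (EmpVec n) :=
  inferInstanceAs (FiniteDimensional ℝ (Fin n → ℝ))

/-- The normalized inner product `⟨u, v⟩ = (1/n) ∑ᵢ uᵢ vᵢ`. -/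
@[reducible] def empCore (n : ℕ) : InnerProductSpace.Core ℝ (EmpVec n) where
  inner u v := (1 / (n : ℝ)) * ∑ i : Fin n, u i * v i
  conj_inner_symm u v := by
    simp [mul_comm]
  re_inner_nonneg u := by
    have : 0 ≤ ∑ i : Fin n, u i * u i := Finset.sum_nonneg fun i _ => mul_self_nonneg (u i)
    simp only [RCLike.re_to_real]
    positivity
  add_left u v w := by
    have : ∀ i, (u + v) i = u i + v i := fun i => rfl
    simp only [this, add_mul, Finset.sum_add_distrib, mul_add]
  smul_left u v r := by
    have : ∀ i, (r • u) i = r * u i := fun i => rfl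
    simp only [this, conj_trivial, mul_assoc, ← Finset.mul_sum]
    ring
  definite u h := by
    funext i
    have hn : (0 : ℝ) < n := by exact_mod_cast i.pos
    have h1 : ∑ j : Fin n, u j * u j = 0 := by
      rcases mul_eq_zero.mp h with h | h
      · exact absurd h (by positivity)
      · exact h
    have h2 := (Finset.sum_eq_zero_iff_of_nonneg fun j _ => mul_self_nonneg (u j)).mp h1 i
      (Finset.mem_univ i)
    exact mul_self_eq_zero.mp h2

instance (n : ℕ) : NormedAddCommGroup (EmpVec n) := (empCore n).toNormedAddCommGroup

instance (n : ℕ) : InnerProductSpace ℝ (EmpVec n) := .ofCore (empCore n).toCore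

/-- The identity from `ℝⁿ` to `ℝⁿ` with the normalized inner product. -/
def toEmp (n : ℕ) : (Fin n → ℝ) →L[ℝ] EmpVec n :=
  LinearMap.toContinuousLinearMap (⟨⟨id, fun _ _ => rfl⟩, fun _ _ => rfl⟩ : (Fin n → ℝ) →ₗ[ℝ] EmpVec n)

/-- `(ℝⁿ)^d`, the Hilbert sum of `d` copies of `ℝⁿ` with the normalized inner product. -/
abbrev EmpGrad (n d : ℕ) : Type := PiLp 2 (fun _ : Fin d => EmpVec n)

/-! ### Differentiability on a set `X ⊆ ℝᵈ` contained in the closure of its interior -/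

open Classical in
/-- Extension by zero. It only serves to differentiate at interior points of `X`, where the values
outside `X` are irrelevant. -/
def extendZero {F : Type*} {X : Set F} (f : X → ℝ) (z : F) : ℝ :=
  if h : z ∈ X then f ⟨z, h⟩ else 0

/-- The partial derivative `∂f/∂xᵃ` at a point of `X`: the limit of the partial derivatives at the
interior points. At an interior point around which `f` is continuously differentiable this is the
usual partial derivative. -/
def partialDeriv {d : ℕ} {X : Set (EuclideanSpace ℝ (Fin d))} (a : Fin d) (f : X → ℝ) (x : X) : ℝ :=
  limUnder (𝓝[interior X] (x : EuclideanSpace ℝ (Fin d)))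
    (fun z => lineDeriv ℝ (extendZero f) z (EuclideanSpace.single a 1))

/-- `g` is of class `C^m` on `s`: it is continuous on `s`, of class `C^m` in the interior of `s`, and
its derivatives up to order `m` extend continuously from the interior to `s`. -/
def IsCkOn {F : Type*} [NormedAddCommGroup F] [NormedSpace ℝ F] (m : ℕ) (s : Set F) (g : F → ℝ) :
    Prop :=
  ContinuousOn g s ∧ ContDiffOn ℝ m g (interior s) ∧
    ∀ j : ℕ, j ≤ m → ∃ G : F → ContinuousMultilinearMap ℝ (fun _ : Fin j => F) ℝ,
      ContinuousOn G s ∧ Set.EqOn G (iteratedFDeriv ℝ j g) (interior s)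

/-! ### The reproducing kernel Hilbert space, sampling operator and empirical gradient -/

section RKHS

variable {d n : ℕ} {X : Set (EuclideanSpace ℝ (Fin d))}
variable (H : Type*) [NormedAddCommGroup H] [InnerProductSpace ℝ H] [CompleteSpace H]
variable [RKHS ℝ H X ℝ]

/-- The real-valued reproducing kernel `k(s, t)` of `H`. -/
def ker (s t : X) : ℝ := RKHS.kernel H s t 1

open Classical in
/-- The kernel as a function on `ℝᵈ × ℝᵈ`, zero outside `X × X`. -/
def kerExt (p : EuclideanSpace ℝ (Fin d) × EuclideanSpace ℝ (Fin d)) : ℝ :=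
  if h : p.1 ∈ X ∧ p.2 ∈ X then ker H (⟨p.1, h.1⟩ : X) (⟨p.2, h.2⟩ : X) else 0

/-- The element `(∂ₐk)ₓ` of `H`: the function `t ↦ ∂k(s, t)/∂sᵃ` at `s = x`. -/
def kerPartial (a : Fin d) (x : X) : H :=
  Classical.epsilon fun h : H => ∀ t : X, h t = partialDeriv a (fun s : X => ker H s t) x

/-- The sampling operator `f ↦ (f(x₁), …, f(xₙ))`. -/
def sampling (x : Fin n → X) : H →L[ℝ] EmpVec n :=
  (toEmp n).comp (ContinuousLinearMap.pi fun i => (ContinuousLinearMap.proj (x i)).comp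
    (RKHS.coeCLM ℝ : H →L[ℝ] X → ℝ))

/-- The `a`-th empirical partial derivative `f ↦ (⟨f, (∂ₐk)_{xᵢ}⟩)ᵢ`. -/
def empDeriv (x : Fin n → X) (a : Fin d) : H →L[ℝ] EmpVec n :=
  (toEmp n).comp (ContinuousLinearMap.pi fun i => innerSL ℝ (kerPartial H a (x i)))

/-- The empirical gradient operator from `H` to `(ℝⁿ)^d`. -/
def empGrad (x : Fin n → X) : H →L[ℝ] EmpGrad n d :=
  ((PiLp.continuousLinearEquiv 2 ℝ (fun _ : Fin d => EmpVec n)).symm :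
      (Fin d → EmpVec n) →L[ℝ] EmpGrad n d).comp
    (ContinuousLinearMap.pi fun a => empDeriv H x a)

variable {H}

/-- The derivative penalty `∑ₐ ‖∂f/∂xᵃ‖ₙ`, with `‖∂f/∂xᵃ‖ₙ² = (1/n) ∑ᵢ (∂f(xᵢ)/∂xᵃ)²`. -/
def penalty (x : Fin n → X) (f : H) : ℝ :=
  ∑ a : Fin d, Real.sqrt ((1 / (n : ℝ)) * ∑ i : Fin n, (partialDeriv a (fun s : X => f s) (x i)) ^ 2)

/-- The objective `(1/n) ∑ᵢ (yᵢ - f(xᵢ))² + τ (2 ∑ₐ ‖∂f/∂xᵃ‖ₙ + ν ‖f‖²)`. -/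
def objective (x : Fin n → X) (y : Fin n → ℝ) (τ ν : ℝ) (f : H) : ℝ :=
  (1 / (n : ℝ)) * ∑ i : Fin n, (y i - f (x i)) ^ 2 + τ * (2 * penalty x f + ν * ‖f‖ ^ 2)

end RKHS

/-! ### The algorithm -/

/-- The metric projection onto a closed convex set: the nearest point. -/
def metricProj {V : Type*} [NormedAddCommGroup V] (S : Set V) (w : V) : V :=
  haveI : Nonempty V := ⟨0⟩
  Classical.epsilon fun p : V => p ∈ S ∧ ∀ q ∈ S, ‖w - p‖ ≤ ‖w - q‖

/-- The product of `d` balls of radius `r` in `ℝⁿ`, that is `r` times the product of unit balls. -/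
def prodBall (n d : ℕ) (r : ℝ) : Set (EmpGrad n d) := {v | ∀ a, ‖v a‖ ≤ r}

section Algorithm

variable {d n : ℕ} {X : Set (EuclideanSpace ℝ (Fin d))}
variable {H : Type*} [NormedAddCommGroup H] [InnerProductSpace ℝ H] [CompleteSpace H]
variable [RKHS ℝ H X ℝ]

/-- The inner projected-gradient iteration
`v^q = π (v^{q-1} - (1/η) ∇ (∇* v^{q-1} - g))`, with `π` the projection onto `r` times the product
of unit balls, started at `v0`. -/
def innerIter (x : Fin n → X) (r η : ℝ) (g : H) (v0 : EmpGrad n d) : ℕ → EmpGrad n d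
  | 0 => v0
  | q + 1 =>
    metricProj (prodBall n d r)
      (innerIter x r η g v0 q - (1 / η) •
        empGrad H x ((empGrad H x).adjoint (innerIter x r η g v0 q) - g))

/-- The forward (gradient) step `(1 - τν/σ) h - (1/σ) S* (S h - y)`. -/
def forwardStep (x : Fin n → X) (y : Fin n → ℝ) (τ ν σ : ℝ) (h : H) : H :=
  (1 - τ * ν / σ) • h - (1 / σ) • (sampling H x).adjoint (sampling H x h - toEmp n y)

/-- `f` is a sequence of iterates of the inexact accelerated forward-backward algorithm, with
momentum parameters `s`, extrapolated points `ft` and dual variables `vbar`; the inner iteration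
of step `t` is run for at least one step, from an arbitrary starting point, and is stopped at an
iterate for which the duality gap is at most `(ε t)²`. The initial points `f 0`, `f 1` are
arbitrary. -/
structure IsInexactFISTA (x : Fin n → X) (y : Fin n → ℝ) (τ ν σ η : ℝ) (ε : ℕ → ℝ)
    (s : ℕ → ℝ) (ft f : ℕ → H) (vbar : ℕ → EmpGrad n d) : Prop where
  s_one : 1 ≤ s 1
  s_step : ∀ t, 2 ≤ t → s t = (1 / 2) * (1 + Real.sqrt (1 + 4 * s (t - 1) ^ 2))
  ft_step : ∀ t, 2 ≤ t → ft t =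
    (1 + (s (t - 1) - 1) / s t) • f (t - 1) + ((1 - s (t - 1)) / s t) • f (t - 2)
  f_step : ∀ t, 2 ≤ t → f t = forwardStep x y τ ν σ (ft t) - (empGrad H x).adjoint (vbar t)
  inner_iter : ∀ t, 2 ≤ t → ∃ (v0 : EmpGrad n d) (q : ℕ), 1 ≤ q ∧
    vbar t = innerIter x (τ / σ) η (forwardStep x y τ ν σ (ft t)) v0 q
  inner_stop : ∀ t, 2 ≤ t →
    2 * τ / σ * penalty x (f t) - 2 * inner ℝ ((empGrad H x).adjoint (vbar t)) (f t) ≤ ε t ^ 2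

end Algorithm

end DerivReg

end

/-! Inner products of difference quotients of the feature map `z ↦ k_z` are mixed difference
quotients of `k`, which converge because `k` is `C²`. A family whose mutual inner products converge
is Cauchy (`exists_tendsto_of_tendsto_inner`), so the feature map is strongly differentiable in the
interior. The same argument with moving base points reaches the boundary, giving
`partialDeriv_eq_inner_kerPartial`. Thus `Ω` is a sum of norms of bounded finite-rank operators.

After at least one inner step the dual variable lies in the product of balls, so the stopping rule
makes `2σ∇*v̄` an approximate subgradient of `2τΩ` at `f^t` with error `σ(ε^t)²`. Together with `σ ≥
‖S*S‖ + τν` this gives the one-step inequality `forwardBackward_le`. In `accelerated_rate` a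
Lyapunov quantity grows by at most `σ s_t² (ε^t)²` per step. These increments are summable since
`s_t = O(t)` and `l > 3/2`, and `s_t ≥ t/2` yields the rate. A minimizer exists by reduction to
finite dimension; quadratic growth converts the rate for values into one for iterates. -/

noncomputable section

namespace DerivReg

/-! ### Mixed difference quotients and convergence in Hilbert spaces -/

/-- The mixed second difference quotients of a `C²` function converge to its second derivative. -/
theorem tendsto_mixed_difference_quotient {F : Type*} [NormedAddCommGroup F] [NormedSpace ℝ F]
    {K : F → ℝ} {p : F} (hK : ContDiffAt ℝ 2 K p) (u v : F) :
    Tendsto (fun h : ℝ × ℝ => h.1⁻¹ * (h.2⁻¹ *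
      (K (p + h.1 • u + h.2 • v) - K (p + h.1 • u) - (K (p + h.2 • v) - K p))))
      (𝓝[≠] 0 ×ˢ 𝓝[≠] 0) (𝓝 (fderiv ℝ (fderiv ℝ K) p v u)) := by
  set L := fderiv ℝ (fderiv ℝ K) p with hL
  -- Strictness is needed: the derivatives compared below sit at two moving points, and the two step
  -- sizes vary independently.
  have hstrict : HasStrictFDerivAt (fderiv ℝ K) L p :=
    (hK.fderiv_right (m := 1) (by norm_num)).hasStrictFDerivAt (by norm_num)
  have hdiff : ∀ᶠ z in 𝓝 p, DifferentiableAt ℝ K z := by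
    filter_upwards [hK.eventually (by simp)] with z hz
    exact hz.differentiableAt (by norm_num)
  rw [Metric.tendsto_nhds]
  intro ε hε
  set c : ℝ := ε / (2 * (‖v‖ * ‖u‖ + 1)) with hc
  have hcpos : 0 < c := by positivity
  have hcε : c * (‖v‖ * ‖u‖) < ε := by
    have h1 : c * (2 * (‖v‖ * ‖u‖ + 1)) = ε := by
      rw [hc]; field_simp
    nlinarith [mul_nonneg hcpos.le (mul_nonneg (norm_nonneg v) (norm_nonneg u))]
  have hlo := hstrict.isLittleO.bound hcpos
  obtain ⟨δ, hδ, hball⟩ : ∃ δ > 0, ∀ z ∈ Metric.ball p δ, ∀ w ∈ Metric.ball p δ,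
      ‖fderiv ℝ K z - fderiv ℝ K w - L (z - w)‖ ≤ c * ‖z - w‖ ∧ DifferentiableAt ℝ K z := by
    have h2 := hlo.and (nhds_prod_eq (x := p) (y := p) ▸ hdiff.prod_inl (𝓝 p))
    rw [Metric.eventually_nhds_iff_ball] at h2
    obtain ⟨δ, hδ, h2⟩ := h2
    refine ⟨δ, hδ, fun z hz w hw => h2 (z, w) ?_⟩
    rw [← ball_prod_same]
    exact ⟨hz, hw⟩
  have hsmall : ∀ᶠ h : ℝ in 𝓝[≠] 0, h ≠ 0 ∧ |h| * (‖u‖ + ‖v‖) < δ / 2 := by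
    refine (eventually_mem_nhdsWithin).and ?_
    have : Tendsto (fun h : ℝ => |h| * (‖u‖ + ‖v‖)) (𝓝[≠] 0) (𝓝 (|(0 : ℝ)| * (‖u‖ + ‖v‖))) :=
      ((by fun_prop : Continuous fun h : ℝ => |h| * (‖u‖ + ‖v‖)).tendsto 0).mono_left
        nhdsWithin_le_nhds
    exact this.eventually (gt_mem_nhds (by simpa using hδ))
  filter_upwards [hsmall.prod_mk hsmall] with h hh
  obtain ⟨⟨h1, h1s⟩, h2, h2s⟩ := hh
  have hmem : ∀ r : ℝ, |r| ≤ |h.1| → p + r • u ∈ Metric.ball p δ ∧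
      p + r • u + h.2 • v ∈ Metric.ball p δ := by
    intro r hr
    have a1 : |r| * ‖u‖ ≤ |h.1| * (‖u‖ + ‖v‖) := by gcongr; linarith [norm_nonneg v]
    have a2 : |h.2| * ‖v‖ ≤ |h.2| * (‖u‖ + ‖v‖) := by gcongr; linarith [norm_nonneg u]
    constructor
    · rw [mem_ball_iff_norm, add_sub_cancel_left, norm_smul, Real.norm_eq_abs]
      linarith
    · rw [mem_ball_iff_norm, add_assoc, add_sub_cancel_left]
      refine (norm_add_le _ _).trans_lt ?_
      rw [norm_smul, norm_smul, Real.norm_eq_abs, Real.norm_eq_abs]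
      linarith
  -- `A h.1 - A 0` is the second difference minus its prediction by `L`; the mean value inequality
  -- in `r` alone bounds it.
  set A : ℝ → ℝ := fun r => K (p + r • u + h.2 • v) - K (p + r • u) - r * (h.2 * L v u) with hA
  have hline : ∀ (q : F) (r : ℝ), DifferentiableAt ℝ K (q + r • u) →
      HasDerivAt (fun r : ℝ => K (q + r • u)) (fderiv ℝ K (q + r • u) u) r := by
    intro q r hq
    have := hq.hasFDerivAt.comp_hasDerivAt r
      (((hasDerivAt_id r).smul_const u).const_add q)
    rw [one_smul] at this
    exact this
  have hAd : ∀ r ∈ Set.uIcc 0 h.1, HasDerivWithinAt A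
      (fderiv ℝ K (p + r • u + h.2 • v) u - fderiv ℝ K (p + r • u) u - h.2 * L v u)
      (Set.uIcc 0 h.1) r := by
    intro r hr
    have hr' : |r| ≤ |h.1| := by simpa using Set.abs_sub_left_of_mem_uIcc hr
    obtain ⟨m1, m2⟩ := hmem r hr'
    have e1 : p + r • u + h.2 • v = (p + h.2 • v) + r • u := by abel
    have d1 := hline (p + h.2 • v) r (by rw [← e1]; exact (hball _ m2 _ m2).2)
    have d2 := hline p r (hball _ m1 _ m1).2
    have d3 := (hasDerivAt_id r).mul_const (h.2 * L v u)
    have d := (d1.sub d2).sub d3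
    rw [← e1] at d
    simp only [one_mul] at d
    refine (d.congr_of_eventuallyEq (Eventually.of_forall fun r => ?_)).hasDerivWithinAt
    simp only [hA, Pi.sub_apply, id]
    rw [add_right_comm]
  have hbd : ∀ r ∈ Set.uIcc 0 h.1,
      ‖fderiv ℝ K (p + r • u + h.2 • v) u - fderiv ℝ K (p + r • u) u - h.2 * L v u‖
        ≤ c * (|h.2| * ‖v‖) * ‖u‖ := by
    intro r hr
    have hr' : |r| ≤ |h.1| := by simpa using Set.abs_sub_left_of_mem_uIcc hr
    obtain ⟨m1, m2⟩ := hmem r hr'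
    have key := (hball _ m2 _ m1).1
    rw [add_sub_cancel_left, norm_smul, Real.norm_eq_abs] at key
    have := (fderiv ℝ K (p + r • u + h.2 • v) - fderiv ℝ K (p + r • u) - L (h.2 • v)).le_of_opNorm_le
      key u
    simpa using this
  have hmv := (convex_uIcc 0 h.1).norm_image_sub_le_of_norm_hasDerivWithin_le hAd hbd
    Set.left_mem_uIcc Set.right_mem_uIcc
  rw [sub_zero, Real.norm_eq_abs, Real.norm_eq_abs] at hmv
  have hfac : h.1⁻¹ * (h.2⁻¹ *
      (K (p + h.1 • u + h.2 • v) - K (p + h.1 • u) - (K (p + h.2 • v) - K p))) - L v u =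
      h.1⁻¹ * (h.2⁻¹ * (A h.1 - A 0)) := by
    simp only [hA]
    simp only [zero_smul, add_zero]
    field_simp
    ring
  rw [Real.dist_eq, hfac, abs_mul, abs_mul, abs_inv, abs_inv]
  have p1 : 0 < |h.1| := abs_pos.mpr h1
  have p2 : 0 < |h.2| := abs_pos.mpr h2
  calc |h.1|⁻¹ * (|h.2|⁻¹ * |A h.1 - A 0|)
      ≤ |h.1|⁻¹ * (|h.2|⁻¹ * (c * (|h.2| * ‖v‖) * ‖u‖ * |h.1|)) := by gcongr
    _ = c * (‖v‖ * ‖u‖) := by field_simp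
    _ < ε := hcε

/-- A family in a Hilbert space whose mutual inner products converge is convergent. -/
theorem exists_tendsto_of_tendsto_inner {ι E : Type*} [NormedAddCommGroup E]
    [InnerProductSpace ℝ E] [CompleteSpace E] {l : Filter ι} [l.NeBot] {F : ι → E} {c : ℝ}
    (h : Tendsto (fun i : ι × ι => inner ℝ (F i.1) (F i.2)) (l ×ˢ l) (𝓝 c)) :
    ∃ D, Tendsto F l (𝓝 D) := by
  have hc : Cauchy (l.map F) := by
    rw [cauchy_map_iff', Metric.uniformity_eq_comap_nhds_zero, tendsto_comap_iff]
    -- The product filter also controls diagonal pairs, so `‖F i - F j‖²` tends to `c - 2c + c = 0`.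
    have h1 := h.comp (tendsto_fst.prodMk (tendsto_fst (f := l) (g := l)))
    have h2 := h.comp (tendsto_snd.prodMk (tendsto_snd (f := l) (g := l)))
    have h3 := (((h1.sub (h.const_mul 2)).add h2).sqrt)
    rw [show c - 2 * c + c = 0 by ring, Real.sqrt_zero] at h3
    refine h3.congr fun i => ?_
    simp only [Function.comp_apply]
    rw [dist_eq_norm, real_inner_self_eq_norm_sq, real_inner_self_eq_norm_sq,
      ← norm_sub_sq_real, Real.sqrt_sq (norm_nonneg _)]
  exact CompleteSpace.complete hc

/-! ### The derivative reproducing property -/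

section Reproducing

variable {d n : ℕ} {X : Set (EuclideanSpace ℝ (Fin d))}
variable {H : Type*} [NormedAddCommGroup H] [InnerProductSpace ℝ H] [CompleteSpace H]
variable [RKHS ℝ H X ℝ]

variable (H) in
open Classical in
/-- The feature map `z ↦ k_z`, extended by zero outside `X`. -/
def feature (z : EuclideanSpace ℝ (Fin d)) : H :=
  if h : z ∈ X then RKHS.kerFun H (⟨z, h⟩ : X) 1 else 0

theorem inner_feature (f : H) (z : EuclideanSpace ℝ (Fin d)) :
    inner ℝ f (feature H z) = extendZero (fun s : X => f s) z := by
  unfold feature extendZero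
  split_ifs with h
  · simp
  · simp

theorem inner_feature_feature (z w : EuclideanSpace ℝ (Fin d)) :
    inner ℝ (feature H z) (feature H w) = kerExt (X := X) H (z, w) := by
  unfold feature kerExt ker
  by_cases hz : z ∈ X <;> by_cases hw : w ∈ X
  · simp only [hz, hw, dif_pos, and_self]
    rw [RKHS.kerFun_inner, RKHS.kerFun_apply]
    simp
  all_goals simp [hz, hw]

/-- The mixed derivative `∂²k(z, w)/∂zᵃ∂wᵃ`. -/
def mixedDeriv (K : EuclideanSpace ℝ (Fin d) × EuclideanSpace ℝ (Fin d) → ℝ) (a : Fin d)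
    (p : EuclideanSpace ℝ (Fin d) × EuclideanSpace ℝ (Fin d)) : ℝ :=
  fderiv ℝ (fderiv ℝ K) p (0, EuclideanSpace.single a 1) (EuclideanSpace.single a 1, 0)

/-- The difference quotients of the feature map. -/
def featureSlope (H : Type*) [NormedAddCommGroup H] [InnerProductSpace ℝ H] [CompleteSpace H]
    [RKHS ℝ H X ℝ] (a : Fin d) (z : EuclideanSpace ℝ (Fin d)) (r : ℝ) : H :=
  r⁻¹ • (feature H (z + r • EuclideanSpace.single a 1) - feature H z)

theorem contDiffAt_kerExt (hk : IsCkOn 2 (X ×ˢ X) (kerExt (X := X) H))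
    {z w : EuclideanSpace ℝ (Fin d)} (hz : z ∈ interior X) (hw : w ∈ interior X) :
    ContDiffAt ℝ 2 (kerExt (X := X) H) (z, w) := by
  refine hk.2.1.contDiffAt (isOpen_interior.mem_nhds ?_)
  rw [interior_prod_eq]
  exact ⟨hz, hw⟩

theorem tendsto_inner_featureSlope (hk : IsCkOn 2 (X ×ˢ X) (kerExt (X := X) H)) (a : Fin d)
    {z w : EuclideanSpace ℝ (Fin d)} (hz : z ∈ interior X) (hw : w ∈ interior X) :
    Tendsto (fun h : ℝ × ℝ => inner ℝ (featureSlope H a z h.1) (featureSlope H a w h.2))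
      (𝓝[≠] 0 ×ˢ 𝓝[≠] 0) (𝓝 (mixedDeriv (kerExt (X := X) H) a (z, w))) := by
  refine (tendsto_mixed_difference_quotient (contDiffAt_kerExt hk hz hw)
    (EuclideanSpace.single a 1, 0) (0, EuclideanSpace.single a 1)).congr fun h => ?_
  simp only [featureSlope, real_inner_smul_left, real_inner_smul_right, inner_sub_left,
    inner_sub_right, inner_feature_feature, Prod.smul_mk, smul_zero, Prod.mk_add_mk, add_zero]
  ring

variable (H) in
/-- The strong derivative of the feature map in direction `a`. -/
def featureDeriv (a : Fin d) (z : EuclideanSpace ℝ (Fin d)) : H :=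
  limUnder (𝓝[≠] (0 : ℝ)) (featureSlope H a z)

theorem tendsto_featureSlope (hk : IsCkOn 2 (X ×ˢ X) (kerExt (X := X) H)) (a : Fin d)
    {z : EuclideanSpace ℝ (Fin d)} (hz : z ∈ interior X) :
    Tendsto (featureSlope H a z) (𝓝[≠] 0) (𝓝 (featureDeriv H a z)) :=
  tendsto_nhds_limUnder (exists_tendsto_of_tendsto_inner (tendsto_inner_featureSlope hk a hz hz))

theorem inner_featureDeriv (hk : IsCkOn 2 (X ×ˢ X) (kerExt (X := X) H)) (a : Fin d)
    {z w : EuclideanSpace ℝ (Fin d)} (hz : z ∈ interior X) (hw : w ∈ interior X) :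
    inner ℝ (featureDeriv H a z) (featureDeriv H a w) = mixedDeriv (kerExt (X := X) H) a (z, w) :=
  tendsto_nhds_unique
    (((tendsto_featureSlope hk a hz).comp tendsto_fst).inner
      ((tendsto_featureSlope hk a hw).comp tendsto_snd))
    (tendsto_inner_featureSlope hk a hz hw)

/-- Pairing the strong limit of the feature slopes with `f` produces the difference quotients of
`f`. -/
theorem lineDeriv_extendZero (hk : IsCkOn 2 (X ×ˢ X) (kerExt (X := X) H)) (a : Fin d)
    {z : EuclideanSpace ℝ (Fin d)} (hz : z ∈ interior X) (f : H) :
    lineDeriv ℝ (extendZero fun s : X => f s) z (EuclideanSpace.single a 1) =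
      inner ℝ f (featureDeriv H a z) := by
  refine HasDerivAt.deriv (hasDerivAt_iff_tendsto_slope_zero.mpr ?_)
  refine (tendsto_const_nhds.inner (tendsto_featureSlope hk a hz)).congr fun r => ?_
  simp only [featureSlope, real_inner_smul_right, inner_sub_right, inner_feature, zero_add,
    zero_smul, add_zero, smul_eq_mul]

/-- Mutual inner products of feature derivatives are mixed derivatives of `k`, which converge at
`(x, x)` because second derivatives extend continuously to `X × X`. -/
theorem exists_tendsto_featureDeriv (hX : closure X = closure (interior X))
    (hk : IsCkOn 2 (X ×ˢ X) (kerExt (X := X) H)) (a : Fin d) (x : X) :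
    ∃ D : H, Tendsto (featureDeriv H a) (𝓝[interior X] (x : EuclideanSpace ℝ (Fin d))) (𝓝 D) := by
  have : (𝓝[interior X] (x : EuclideanSpace ℝ (Fin d))).NeBot :=
    mem_closure_iff_nhdsWithin_neBot.mp (hX ▸ subset_closure x.2)
  obtain ⟨G, hG, hGeq⟩ := hk.2.2 2 le_rfl
  have hGx := hG (x, x) ⟨x.2, x.2⟩
  set m : Fin 2 → EuclideanSpace ℝ (Fin d) × EuclideanSpace ℝ (Fin d) :=
    ![(0, EuclideanSpace.single a 1), (EuclideanSpace.single a 1, 0)] with hm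
  have happ : Tendsto (fun p => G p m) (𝓝[X ×ˢ X] ((x : EuclideanSpace ℝ (Fin d)), (x : EuclideanSpace ℝ (Fin d)))) (𝓝 (G (x, x) m)) :=
    ((ContinuousMultilinearMap.apply ℝ _ ℝ m).continuous.tendsto _).comp hGx
  have hsub : 𝓝[interior X] (x : EuclideanSpace ℝ (Fin d)) ×ˢ
      𝓝[interior X] (x : EuclideanSpace ℝ (Fin d)) ≤
      𝓝[X ×ˢ X] ((x : EuclideanSpace ℝ (Fin d)), (x : EuclideanSpace ℝ (Fin d))) := by
    rw [nhdsWithin_prod_eq]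
    exact Filter.prod_mono (nhdsWithin_mono _ interior_subset) (nhdsWithin_mono _ interior_subset)
  refine exists_tendsto_of_tendsto_inner (c := G (x, x) m) ((happ.mono_left hsub).congr' ?_)
  have hin : ∀ᶠ z in 𝓝[interior X] (x : EuclideanSpace ℝ (Fin d)), z ∈ interior X :=
    eventually_mem_nhdsWithin
  filter_upwards [hin.prod_mk hin] with p hp
  rw [inner_featureDeriv hk a hp.1 hp.2, mixedDeriv, hGeq (by rw [interior_prod_eq]; exact hp),
    iteratedFDeriv_two_apply]
  rfl

theorem partialDeriv_eq_inner_of_tendsto (hX : closure X = closure (interior X))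
    (hk : IsCkOn 2 (X ×ˢ X) (kerExt (X := X) H)) (a : Fin d) (x : X) {D : H}
    (hD : Tendsto (featureDeriv H a) (𝓝[interior X] (x : EuclideanSpace ℝ (Fin d))) (𝓝 D))
    (f : H) : partialDeriv a (fun s : X => f s) x = inner ℝ f D := by
  have : (𝓝[interior X] (x : EuclideanSpace ℝ (Fin d))).NeBot :=
    mem_closure_iff_nhdsWithin_neBot.mp (hX ▸ subset_closure x.2)
  refine Tendsto.limUnder_eq ((tendsto_const_nhds.inner hD).congr' ?_)
  filter_upwards [eventually_mem_nhdsWithin] with z hz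
  exact (lineDeriv_extendZero hk a hz f).symm

/-- The derivative reproducing property, also at boundary points. -/
theorem partialDeriv_eq_inner_kerPartial (hX : closure X = closure (interior X))
    (hk : IsCkOn 2 (X ×ˢ X) (kerExt (X := X) H)) (a : Fin d) (x : X) (f : H) :
    partialDeriv a (fun s : X => f s) x = inner ℝ f (kerPartial H a x) := by
  obtain ⟨D, hD⟩ := exists_tendsto_featureDeriv hX hk a x
  have hrep := partialDeriv_eq_inner_of_tendsto hX hk a x hD
  -- Testing on `f = k_t` shows that `D` meets the description by which `kerPartial` was chosen; its
  -- values determine it.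
  have hDt : ∀ t : X, D t = partialDeriv a (fun s : X => ker H s t) x := by
    intro t
    have h := hrep (RKHS.kerFun H t 1)
    simp only [RKHS.kerFun_apply] at h
    unfold ker
    rw [h]
    simp
  have hex : ∃ h : H, ∀ t : X, h t = partialDeriv a (fun s : X => ker H s t) x := ⟨D, hDt⟩
  have hkp : kerPartial H a x = D :=
    RKHS.ext fun t => (Classical.epsilon_spec hex t).trans (hDt t).symm
  rw [hkp, hrep]

end Reproducing

/-! ### The inexact accelerated forward-backward method in a Hilbert space -/

section ForwardBackward

variable {H W : Type*} [NormedAddCommGroup H] [InnerProductSpace ℝ H] [CompleteSpace H]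
  [NormedAddCommGroup W] [InnerProductSpace ℝ W] [CompleteSpace W]

/-- The exact second order expansion of a regularized least squares functional. -/
theorem leastSquares_expansion (S : H →L[ℝ] W) (y : W) (c : ℝ) (h f : H) :
    ‖S f - y‖ ^ 2 + c * ‖f‖ ^ 2 = ‖S h - y‖ ^ 2 + c * ‖h‖ ^ 2
      + 2 * inner ℝ (S.adjoint (S h - y) + c • h) (f - h)
      + (‖S (f - h)‖ ^ 2 + c * ‖f - h‖ ^ 2) := by
  have h1 : S f - y = (S h - y) + S (f - h) := by rw [map_sub]; abel
  have h2 : f = h + (f - h) := by abel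
  rw [inner_add_left, ContinuousLinearMap.adjoint_inner_left, real_inner_smul_left, h1,
    norm_add_sq_real]
  have h3 : ‖f‖ ^ 2 = ‖h‖ ^ 2 + 2 * inner ℝ h (f - h) + ‖f - h‖ ^ 2 := by
    rw [← norm_add_sq_real, ← h2]
  rw [h3]
  ring

theorem norm_apply_sq_le (S : H →L[ℝ] W) (u : H) :
    ‖S u‖ ^ 2 ≤ ‖S.adjoint ∘L S‖ * ‖u‖ ^ 2 := by
  rw [ContinuousLinearMap.norm_adjoint_comp_self, ← sq, ← mul_pow]
  gcongr
  exact S.le_opNorm u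

/-- The basic inequality of an inexact forward-backward step: `ξ` is an approximate subgradient
of the nonsmooth part `J` at the new point `f`. -/
theorem forwardBackward_le {S : H →L[ℝ] W} {y : W} {c σ e : ℝ} (hc : 0 ≤ c) (hσ : 0 < σ)
    (hSσ : ‖S.adjoint ∘L S‖ + c ≤ σ) {J : H → ℝ} {h f ξ u : H}
    (hf : f = (1 - c / σ) • h - (1 / σ) • S.adjoint (S h - y) - ξ)
    (hξ : J f + 2 * σ * inner ℝ ξ (u - f) - σ * e ≤ J u) :
    (‖S f - y‖ ^ 2 + c * ‖f‖ ^ 2 + J f) - (‖S u - y‖ ^ 2 + c * ‖u‖ ^ 2 + J u) ≤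
      σ * (‖h - u‖ ^ 2 - ‖f - u‖ ^ 2) + σ * e := by
  -- Half the gradient of the smooth part at `h`, read off from the update formula.
  have hD : S.adjoint (S h - y) + c • h = σ • (h - f - ξ) := by
    rw [hf]
    have : σ * (1 / σ) = 1 := by field_simp
    have h2 : σ * (c / σ) = c := by field_simp
    simp only [smul_sub, smul_smul, sub_smul, this, h2, one_smul]
    abel
  have e1 := leastSquares_expansion S y c h f
  have e2 := leastSquares_expansion S y c h u
  rw [hD, real_inner_smul_left] at e1 e2
  -- The quadratic remainder is at most `σ‖f - h‖²` at `f` (smoothness) and nonnegative at `u`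
  -- (convexity).
  have b1 := norm_apply_sq_le S (f - h)
  have b2 : 0 ≤ ‖S (u - h)‖ ^ 2 + c * ‖u - h‖ ^ 2 := by positivity
  have b3 : (‖S.adjoint ∘L S‖ + c) * ‖f - h‖ ^ 2 ≤ σ * ‖f - h‖ ^ 2 := by gcongr
  have i1 : inner ℝ (h - f - ξ) (f - h) - inner ℝ (h - f - ξ) (u - h)
      = - inner ℝ (h - f) (u - f) + inner ℝ ξ (u - f) := by
    rw [← inner_sub_right, ← inner_neg_left, ← inner_add_left]
    rw [show f - h - (u - h) = -(u - f) by abel, inner_neg_right, ← inner_neg_left]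
    congr 1
    abel
  have i2 : ‖h - u‖ ^ 2 = ‖f - h‖ ^ 2 - 2 * inner ℝ (h - f) (u - f) + ‖f - u‖ ^ 2 := by
    rw [show h - u = (h - f) - (u - f) by abel, norm_sub_sq_real, norm_sub_rev f h,
      norm_sub_rev f u]
  rw [i2]
  nlinarith

end ForwardBackward

/-! ### Growth of the momentum parameters -/

section Momentum

variable {s : ℕ → ℝ}

theorem momentum_ge_one (h1 : 1 ≤ s 1)
    (hs : ∀ t, 2 ≤ t → s t = (1 / 2) * (1 + Real.sqrt (1 + 4 * s (t - 1) ^ 2)))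
    {t : ℕ} (ht : 1 ≤ t) : 1 ≤ s t := by
  induction t, ht using Nat.le_induction with
  | base => exact h1
  | succ t ht ih =>
    rw [hs (t + 1) (by omega), Nat.add_sub_cancel]
    have : 1 ≤ Real.sqrt (1 + 4 * s t ^ 2) := Real.one_le_sqrt.mpr (by nlinarith)
    linarith

/-- The recursion selects the larger root of this quadratic; the identity is what makes the Lyapunov
argument telescope. -/
theorem momentum_sq (hs : ∀ t, 2 ≤ t → s t = (1 / 2) * (1 + Real.sqrt (1 + 4 * s (t - 1) ^ 2)))
    {t : ℕ} (ht : 1 ≤ t) : s (t + 1) ^ 2 - s (t + 1) = s t ^ 2 := by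
  have h := hs (t + 1) (by omega)
  rw [Nat.add_sub_cancel] at h
  have hsq := Real.sq_sqrt (show 0 ≤ 1 + 4 * s t ^ 2 by positivity)
  rw [h]
  linear_combination hsq / 4

/-- Each step gains at least `1/2`, since `(s (t+1) - 1/2)² = s t ² + 1/4`. -/
theorem momentum_lower (h1 : 1 ≤ s 1)
    (hs : ∀ t, 2 ≤ t → s t = (1 / 2) * (1 + Real.sqrt (1 + 4 * s (t - 1) ^ 2)))
    {t : ℕ} (ht : 1 ≤ t) : (t : ℝ) / 2 ≤ s t := by
  induction t, ht using Nat.le_induction with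
  | base => push_cast; linarith
  | succ t ht ih =>
    have a := momentum_sq hs ht
    have b := momentum_ge_one h1 hs ht
    have c := momentum_ge_one h1 hs (t := t + 1) (by omega)
    push_cast
    nlinarith

/-- Each step gains at most `1`, which is absorbed by `s 1 ≥ 1`. -/
theorem momentum_upper (h1 : 1 ≤ s 1)
    (hs : ∀ t, 2 ≤ t → s t = (1 / 2) * (1 + Real.sqrt (1 + 4 * s (t - 1) ^ 2)))
    {t : ℕ} (ht : 1 ≤ t) : s t ≤ s 1 * t := by
  induction t, ht using Nat.le_induction with
  | base => simp
  | succ t ht ih =>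
    have a := momentum_sq hs ht
    have b := momentum_ge_one h1 hs ht
    have c := momentum_ge_one h1 hs (t := t + 1) (by omega)
    push_cast
    nlinarith

/-- Errors of order `t^{-l}` with `l > 3/2` are square summable against the momentum weights. -/
theorem summable_momentum_sq_mul_error (h1 : 1 ≤ s 1)
    (hs : ∀ t, 2 ≤ t → s t = (1 / 2) * (1 + Real.sqrt (1 + 4 * s (t - 1) ^ 2)))
    {l : ℝ} (hl : 3 / 2 < l) {ε : ℕ → ℝ} (hε : ε =O[atTop] fun t : ℕ => (t : ℝ) ^ (-l)) :
    Summable fun t => s t ^ 2 * ε t ^ 2 := by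
  have hsO : s =O[atTop] fun t : ℕ => (t : ℝ) := by
    refine IsBigO.of_bound (s 1) ?_
    filter_upwards [eventually_ge_atTop 1] with t ht
    rw [Real.norm_of_nonneg (by linarith [momentum_ge_one h1 hs ht]),
      Real.norm_of_nonneg (Nat.cast_nonneg t)]
    exact momentum_upper h1 hs ht
  refine summable_of_isBigO_nat (Real.summable_nat_rpow.mpr (show 2 - 2 * l < -1 by linarith)) ?_
  refine ((hsO.pow 2).mul (hε.pow 2)).trans (EventuallyEq.isBigO ?_)
  filter_upwards [eventually_gt_atTop 0] with t ht
  have ht' : (0 : ℝ) < t := by exact_mod_cast ht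
  rw [← Real.rpow_natCast (t : ℝ) 2, ← Real.rpow_natCast ((t : ℝ) ^ (-l)) 2, ← Real.rpow_mul ht'.le,
    ← Real.rpow_add ht']
  congr 1
  push_cast
  ring

end Momentum

/-- The `O(1/t²)` rate of accelerated descent, from the one-step inequality
`E (f t) - E u ≤ σ (‖f̃ t - u‖² - ‖f t - u‖²) + σ (ε t)²`. -/
theorem accelerated_rate {H : Type*} [NormedAddCommGroup H] [InnerProductSpace ℝ H]
    {E : H → ℝ} (hE : ConvexOn ℝ Set.univ E) {σ : ℝ} (hσ : 0 < σ)
    {s ε : ℕ → ℝ} {ft f : ℕ → H} (h1 : 1 ≤ s 1)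
    (hs : ∀ t, 2 ≤ t → s t = (1 / 2) * (1 + Real.sqrt (1 + 4 * s (t - 1) ^ 2)))
    (hft : ∀ t, 2 ≤ t → ft t =
      (1 + (s (t - 1) - 1) / s t) • f (t - 1) + ((1 - s (t - 1)) / s t) • f (t - 2))
    (hstep : ∀ t, 2 ≤ t → ∀ u, E (f t) - E u ≤
      σ * (‖ft t - u‖ ^ 2 - ‖f t - u‖ ^ 2) + σ * ε t ^ 2)
    (hsum : Summable fun t => s t ^ 2 * ε t ^ 2) (fz : H) :
    ∃ C : ℝ, 0 < C ∧ ∀ t : ℕ, 1 ≤ t → E (f t) - E fz ≤ C / (t : ℝ) ^ 2 := by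
  set p : ℕ → H := fun t => s t • f t - (s t - 1) • f (t - 1) with hp
  -- The Lyapunov quantity; without errors it would be nonincreasing.
  set a : ℕ → ℝ := fun t => s t ^ 2 * (E (f t) - E fz) + σ * ‖p t - fz‖ ^ 2 with ha
  have hrec : ∀ t, 1 ≤ t → a (t + 1) ≤ a t + σ * (s (t + 1) ^ 2 * ε (t + 1) ^ 2) := by
    intro t ht
    have hS1 := momentum_ge_one h1 hs (t := t + 1) (by omega)
    have hsq := momentum_sq hs ht
    have hft' := hft (t + 1) (by omega)
    simp only [Nat.add_sub_cancel, show t + 1 - 2 = t - 1 by omega] at hft'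
    set S := s (t + 1) with hS
    have hS0 : S ≠ 0 := by positivity
    -- With this comparison point, scaling by `S` turns both distances of the one-step inequality
    -- into consecutive values of `‖p - fz‖`.
    set u : H := (1 - 1 / S) • f t + (1 / S) • fz with hu
    have hconv : E u ≤ (1 - 1 / S) * E (f t) + (1 / S) * E fz :=
      hE.2 (Set.mem_univ _) (Set.mem_univ _)
        (sub_nonneg.mpr (div_le_one_of_le₀ hS1 (by positivity))) (by positivity) (by ring)
    have hst := hstep (t + 1) (by omega) u
    have hSu : S • u = (S - 1) • f t + fz := by
      rw [hu, smul_add, smul_smul, smul_smul, mul_one_div_cancel hS0, mul_sub,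
        mul_one_div_cancel hS0, mul_one, one_smul]
    have g1 : S • (ft (t + 1) - u) = p t - fz := by
      rw [smul_sub, hSu, hft', smul_add, smul_smul, smul_smul, mul_add, mul_one,
        mul_div_cancel₀ _ hS0, mul_div_cancel₀ _ hS0, hp]
      module
    have g2 : S • (f (t + 1) - u) = p (t + 1) - fz := by
      rw [smul_sub, hSu, hp]
      simp only [Nat.add_sub_cancel]
      module
    have n1 : S ^ 2 * ‖ft (t + 1) - u‖ ^ 2 = ‖p t - fz‖ ^ 2 := by
      rw [← g1, norm_smul, mul_pow, Real.norm_eq_abs, sq_abs]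
    have n2 : S ^ 2 * ‖f (t + 1) - u‖ ^ 2 = ‖p (t + 1) - fz‖ ^ 2 := by
      rw [← g2, norm_smul, mul_pow, Real.norm_eq_abs, sq_abs]
    have hm : S ^ 2 * (E (f (t + 1)) - ((1 - 1 / S) * E (f t) + (1 / S) * E fz)) ≤
        S ^ 2 * (σ * (‖ft (t + 1) - u‖ ^ 2 - ‖f (t + 1) - u‖ ^ 2) + σ * ε (t + 1) ^ 2) := by
      gcongr
      linarith
    have hl : S ^ 2 * (E (f (t + 1)) - ((1 - 1 / S) * E (f t) + (1 / S) * E fz)) =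
        S ^ 2 * (E (f (t + 1)) - E fz) - (S ^ 2 - S) * (E (f t) - E fz) := by
      field_simp
      ring
    have hr : S ^ 2 * (σ * (‖ft (t + 1) - u‖ ^ 2 - ‖f (t + 1) - u‖ ^ 2) + σ * ε (t + 1) ^ 2) =
        σ * ‖p t - fz‖ ^ 2 - σ * ‖p (t + 1) - fz‖ ^ 2 + σ * (S ^ 2 * ε (t + 1) ^ 2) := by
      rw [← n1, ← n2]; ring
    rw [hl, hr, hsq] at hm
    simp only [ha, ← hS]
    linarith
  have hnn : ∀ t, 0 ≤ s t ^ 2 * ε t ^ 2 := fun t => by positivity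
  have hbound : ∀ t, 1 ≤ t → a t ≤ a 1 + σ * ∑ j ∈ Finset.range (t + 1), s j ^ 2 * ε j ^ 2 := by
    intro t ht
    induction t, ht using Nat.le_induction with
    | base =>
      have := Finset.sum_nonneg fun j (_ : j ∈ Finset.range (1 + 1)) => hnn j
      nlinarith
    | succ t ht ih =>
      rw [Finset.sum_range_succ, mul_add]
      linarith [hrec t ht]
  set M := a 1 + σ * ∑' j, s j ^ 2 * ε j ^ 2 with hM
  -- The `4` comes from `s t ≥ t / 2`. As `fz` is arbitrary here, `M` may be negative, hence `|M| +
  -- 1`.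
  refine ⟨4 * (|M| + 1), by positivity, fun t ht => ?_⟩
  have haM : a t ≤ |M| + 1 := by
    have := hsum.sum_le_tsum (Finset.range (t + 1)) fun j _ => hnn j
    have h2 := hbound t ht
    have h3 := le_abs_self M
    nlinarith
  have ht0 : (0 : ℝ) < t := by exact_mod_cast ht
  have hlow := momentum_lower h1 hs ht
  have hsE : s t ^ 2 * (E (f t) - E fz) ≤ |M| + 1 := by
    have : 0 ≤ σ * ‖p t - fz‖ ^ 2 := by positivity
    simp only [ha] at haM
    linarith
  rw [le_div_iff₀ (by positivity)]
  rcases le_total (E (f t) - E fz) 0 with hneg | hpos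
  · nlinarith [mul_nonneg (neg_nonneg.mpr hneg) (sq_nonneg (t : ℝ)), abs_nonneg M]
  · have : (t : ℝ) ^ 2 ≤ 4 * s t ^ 2 := by nlinarith
    nlinarith

/-! ### Existence of minimizers -/

/-- A coercive continuous function of finitely many linear functionals, plus a multiple of the
squared norm, has a minimizer. -/
theorem exists_isMinOn_comp_add_norm_sq {H W : Type*} [NormedAddCommGroup H]
    [InnerProductSpace ℝ H] [CompleteSpace H] [NormedAddCommGroup W] [NormedSpace ℝ W]
    [FiniteDimensional ℝ W] (B : H →L[ℝ] W) {Φ : W → ℝ} (hΦ : Continuous Φ)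
    (hb : ∀ r, Bornology.IsBounded {w | Φ w ≤ r}) {c : ℝ} (hc : 0 ≤ c) :
    ∃ fz : H, IsMinOn (fun f => Φ (B f) + c * ‖f‖ ^ 2) Set.univ fz := by
  -- Removing the kernel component keeps `B f` and does not increase the norm, so minimizing over
  -- `V` suffices. There `B` is injective, so `V` is finite-dimensional and sublevel sets are
  -- bounded, even if `c = 0`.
  set V : Submodule ℝ H := (LinearMap.ker (B : H →ₗ[ℝ] W))ᗮ with hV
  have hclosed : IsClosed ((LinearMap.ker (B : H →ₗ[ℝ] W) : Submodule ℝ H) : Set H) :=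
    B.isClosed_ker
  have : CompleteSpace (LinearMap.ker (B : H →ₗ[ℝ] W)) := hclosed.completeSpace_coe
  set BV : V →ₗ[ℝ] W := (B : H →ₗ[ℝ] W).domRestrict V with hBV
  have hinj : LinearMap.ker BV = ⊥ := by
    rw [LinearMap.ker_eq_bot']
    rintro ⟨v, hv⟩ h0
    have h0' : v ∈ LinearMap.ker (B : H →ₗ[ℝ] W) := h0
    have := Submodule.inner_right_of_mem_orthogonal h0' hv
    rw [inner_self_eq_zero] at this
    exact Subtype.ext this
  have : FiniteDimensional ℝ V :=
    FiniteDimensional.of_injective BV (LinearMap.ker_eq_bot.mp hinj)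
  have : ProperSpace V := FiniteDimensional.proper_real V
  obtain ⟨κ, -, hκ⟩ := BV.exists_antilipschitzWith hinj
  have hcont : Continuous fun v : V => Φ (B v) + c * ‖(v : H)‖ ^ 2 := by fun_prop
  obtain ⟨v, hv⟩ := hcont.exists_forall_le_of_isBounded 0 (by
    refine (hκ.isBounded_preimage (hb (Φ (B (0 : V)) + c * ‖((0 : V) : H)‖ ^ 2))).subset ?_
    intro v hv
    have hv' : Φ (B v) + c * ‖(v : H)‖ ^ 2 ≤ Φ (B (0 : V)) + c * ‖((0 : V) : H)‖ ^ 2 := hv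
    have : 0 ≤ c * ‖(v : H)‖ ^ 2 := by positivity
    change Φ (B v) ≤ _
    linarith)
  refine ⟨v, fun f _ => ?_⟩
  set k : H := (LinearMap.ker (B : H →ₗ[ℝ] W)).starProjection f with hk
  have hkmem : k ∈ LinearMap.ker (B : H →ₗ[ℝ] W) := Submodule.starProjection_apply_mem _ f
  have hw : f - k ∈ V := Submodule.sub_starProjection_mem_orthogonal f
  have hBk : B (f - k) = B f := by
    have : B k = 0 := hkmem
    rw [map_sub, this, sub_zero]
  have hnorm : ‖f - k‖ ^ 2 ≤ ‖f‖ ^ 2 := by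
    have horth := Submodule.inner_right_of_mem_orthogonal hkmem hw
    have : ‖f‖ ^ 2 = ‖k‖ ^ 2 + 2 * inner ℝ k (f - k) + ‖f - k‖ ^ 2 := by
      rw [← norm_add_sq_real]; congr 2; abel
    rw [this, horth]
    nlinarith [sq_nonneg ‖k‖]
  have := hv ⟨f - k, hw⟩
  simp only [hBk] at this
  refine this.trans ?_
  simp only
  gcongr

/-! ### Convexity -/

section Convexity

variable {H W : Type*} [NormedAddCommGroup H] [NormedSpace ℝ H] [NormedAddCommGroup W]
  [NormedSpace ℝ W]

theorem convexOn_norm_apply_sub (S : H →L[ℝ] W) (y : W) :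
    ConvexOn ℝ Set.univ fun f => ‖S f - y‖ := by
  refine ⟨convex_univ, fun u _ v _ a b ha hb hab => ?_⟩
  have : S (a • u + b • v) - y = a • (S u - y) + b • (S v - y) := by
    rw [map_add, map_smul, map_smul]
    nth_rewrite 1 [← one_smul ℝ y]
    rw [← hab]
    module
  simp only [this]
  refine (norm_add_le _ _).trans_eq ?_
  rw [norm_smul, norm_smul, Real.norm_of_nonneg ha, Real.norm_of_nonneg hb, smul_eq_mul,
    smul_eq_mul]

theorem convexOn_sum {ι : Type*} (t : Finset ι) {g : ι → H → ℝ}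
    (h : ∀ i, ConvexOn ℝ Set.univ (g i)) : ConvexOn ℝ Set.univ fun f => ∑ i ∈ t, g i f := by
  classical
  induction t using Finset.induction_on with
  | empty => simpa using convexOn_const (0 : ℝ) convex_univ
  | insert i t hi ih =>
    simp only [Finset.sum_insert hi]
    exact (h i).add ih

/-- Quadratic growth at a minimizer of a convex function plus `c ‖·‖²`. -/
theorem quadratic_growth {H : Type*} [NormedAddCommGroup H] [InnerProductSpace ℝ H]
    {G : H → ℝ} (hG : ConvexOn ℝ Set.univ G) {c : ℝ} {fz : H}
    (hmin : IsMinOn (fun f => G f + c * ‖f‖ ^ 2) Set.univ fz) (f : H) :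
    c / 2 * ‖f - fz‖ ^ 2 ≤ (G f + c * ‖f‖ ^ 2) - (G fz + c * ‖fz‖ ^ 2) := by
  -- Comparing `fz` with the midpoint and using the parallelogram identity gives the factor `c / 2`.
  have h1 := hG.2 (Set.mem_univ f) (Set.mem_univ fz)
    (show (0 : ℝ) ≤ 1 / 2 by norm_num) (show (0 : ℝ) ≤ 1 / 2 by norm_num) (by norm_num)
  have h2 : G fz + c * ‖fz‖ ^ 2 ≤ G ((1 / 2 : ℝ) • f + (1 / 2 : ℝ) • fz) +
      c * ‖(1 / 2 : ℝ) • f + (1 / 2 : ℝ) • fz‖ ^ 2 := hmin (Set.mem_univ _)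
  have h3 : ‖(1 / 2 : ℝ) • f + (1 / 2 : ℝ) • fz‖ ^ 2 =
      ‖f‖ ^ 2 / 2 + ‖fz‖ ^ 2 / 2 - ‖f - fz‖ ^ 2 / 4 := by
    rw [← smul_add, norm_smul, mul_pow, norm_add_sq_real, norm_sub_sq_real]
    norm_num
    ring
  rw [h3] at h2
  simp only [smul_eq_mul] at h1
  linarith

end Convexity

/-! ### The derivative-regularized objective -/

theorem norm_empVec_sq {n : ℕ} (u : EmpVec n) : ‖u‖ ^ 2 = (1 / (n : ℝ)) * ∑ i, u i ^ 2 := by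
  rw [← real_inner_self_eq_norm_sq]
  simp only [sq]
  rfl

theorem metricProj_mem {V : Type*} [NormedAddCommGroup V] [ProperSpace V] {S : Set V}
    (hS : IsClosed S) (hne : S.Nonempty) (w : V) : metricProj S w ∈ S := by
  obtain ⟨p, hp, hd⟩ := hS.exists_infDist_eq_dist hne w
  have hex : ∃ p, p ∈ S ∧ ∀ q ∈ S, ‖w - p‖ ≤ ‖w - q‖ := by
    refine ⟨p, hp, fun q hq => ?_⟩
    rw [← dist_eq_norm, ← dist_eq_norm, ← hd]
    exact Metric.infDist_le_dist_of_mem hq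
  exact (Classical.epsilon_spec hex).1

theorem isClosed_prodBall (n d : ℕ) (r : ℝ) : IsClosed (prodBall n d r) := by
  have : prodBall n d r = ⋂ a, {v | ‖v a‖ ≤ r} := by ext; simp [prodBall]
  rw [this]
  refine isClosed_iInter fun a => isClosed_le ?_ continuous_const
  fun_prop

section Objective

variable {d n : ℕ} {X : Set (EuclideanSpace ℝ (Fin d))}
variable {H : Type*} [NormedAddCommGroup H] [InnerProductSpace ℝ H] [CompleteSpace H]
variable [RKHS ℝ H X ℝ]

/-- Once `q ≥ 1` the last operation is a projection, so the starting point does not matter. -/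
theorem innerIter_mem_prodBall (x : Fin n → X) {r : ℝ} (hr : 0 ≤ r) (η : ℝ) (g : H)
    (v0 : EmpGrad n d) {q : ℕ} (hq : 1 ≤ q) : innerIter x r η g v0 q ∈ prodBall n d r := by
  obtain ⟨q, rfl⟩ := Nat.exists_eq_add_of_le' hq
  have : ProperSpace (EmpGrad n d) := FiniteDimensional.proper_real _
  exact metricProj_mem (isClosed_prodBall n d r) ⟨0, fun a => by simpa using hr⟩ _

theorem penalty_eq_sum_norm (hX : closure X = closure (interior X))
    (hk : IsCkOn 2 (X ×ˢ X) (kerExt (X := X) H)) (x : Fin n → X) (f : H) :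
    penalty x f = ∑ a : Fin d, ‖empDeriv H x a f‖ := by
  refine Finset.sum_congr rfl fun a _ => ?_
  rw [← Real.sqrt_sq (norm_nonneg (empDeriv H x a f)), norm_empVec_sq]
  congr 3
  funext i
  rw [partialDeriv_eq_inner_kerPartial hX hk, real_inner_comm]
  rfl

/-- Cauchy–Schwarz block by block: the penalty dominates every dual feasible functional. -/
theorem inner_adjoint_empGrad_le (x : Fin n → X) {r : ℝ} {v : EmpGrad n d}
    (hv : v ∈ prodBall n d r) (u : H) :
    inner ℝ ((empGrad H x).adjoint v) u ≤ r * ∑ a : Fin d, ‖empDeriv H x a u‖ := by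
  rw [ContinuousLinearMap.adjoint_inner_left, PiLp.inner_apply, Finset.mul_sum]
  refine Finset.sum_le_sum fun a _ => ?_
  refine (real_inner_le_norm _ _).trans ?_
  exact mul_le_mul_of_nonneg_right (hv a) (norm_nonneg _)

theorem objective_eq (hX : closure X = closure (interior X))
    (hk : IsCkOn 2 (X ×ˢ X) (kerExt (X := X) H)) (x : Fin n → X) (y : Fin n → ℝ) (τ ν : ℝ)
    (f : H) : objective x y τ ν f = (‖sampling H x f - toEmp n y‖ ^ 2 +
      2 * τ * ∑ a : Fin d, ‖empDeriv H x a f‖) + τ * ν * ‖f‖ ^ 2 := by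
  have h : (1 / (n : ℝ)) * ∑ i : Fin n, (y i - f (x i)) ^ 2 =
      ‖sampling H x f - toEmp n y‖ ^ 2 := by
    rw [norm_empVec_sq]
    congr 1
    refine Finset.sum_congr rfl fun i _ => ?_
    have : (sampling H x f - toEmp n y) i = f (x i) - y i := rfl
    rw [this]
    ring
  rw [objective, h, penalty_eq_sum_norm hX hk]
  ring

theorem convexOn_dataFit_add_penalty (x : Fin n → X) (y : EmpVec n) {τ : ℝ} (hτ : 0 ≤ τ) :
    ConvexOn ℝ Set.univ fun f : H => ‖sampling H x f - y‖ ^ 2 +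
      2 * τ * ∑ a : Fin d, ‖empDeriv H x a f‖ := by
  refine ((convexOn_norm_apply_sub _ _).pow (fun _ _ => norm_nonneg _) 2).add
    ((convexOn_sum Finset.univ fun a => ?_).smul (by positivity : 0 ≤ 2 * τ))
  simpa using convexOn_norm_apply_sub (empDeriv H x a) 0

/-- Data fit and penalty alone are coercive in the finitely many sampled values and derivatives,
since `τ > 0`; this covers `ν = 0`. -/
theorem exists_isMinOn_objective (hX : closure X = closure (interior X))
    (hk : IsCkOn 2 (X ×ˢ X) (kerExt (X := X) H)) (x : Fin n → X) (y : Fin n → ℝ) {τ ν : ℝ}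
    (hτ : 0 < τ) (hν : 0 ≤ ν) :
    ∃ fz : H, IsMinOn (objective x y τ ν) Set.univ fz := by
  have heq : (objective x y τ ν : H → ℝ) = _ := funext (objective_eq hX hk x y τ ν)
  rw [heq]
  refine exists_isMinOn_comp_add_norm_sq
    (B := (sampling H x).prod (ContinuousLinearMap.pi fun a => empDeriv H x a))
    (Φ := fun w : EmpVec n × (Fin d → EmpVec n) =>
      ‖w.1 - toEmp n y‖ ^ 2 + 2 * τ * ∑ a, ‖w.2 a‖) (by fun_prop) (fun r => ?_) (by positivity)
  refine (Metric.isBounded_closedBall (x := (0 : EmpVec n × (Fin d → EmpVec n)))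
    (r := (‖toEmp n y‖ + (|r| + 1)) + |r| / (2 * τ))).subset fun w hw => ?_
  have hw' : ‖w.1 - toEmp n y‖ ^ 2 + 2 * τ * ∑ a, ‖w.2 a‖ ≤ |r| := le_trans hw (le_abs_self r)
  have hs : 0 ≤ ∑ a, ‖w.2 a‖ := Finset.sum_nonneg fun a _ => norm_nonneg _
  have h1 : ‖w.1 - toEmp n y‖ ≤ |r| + 1 := by
    have : 0 ≤ 2 * τ * ∑ a, ‖w.2 a‖ := by positivity
    nlinarith [abs_nonneg r, sq_nonneg (‖w.1 - toEmp n y‖ - 1)]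
  have h2 : ∑ a, ‖w.2 a‖ ≤ |r| / (2 * τ) := by
    rw [le_div_iff₀ (by positivity)]
    nlinarith [sq_nonneg ‖w.1 - toEmp n y‖]
  have h3 : ‖w.1‖ ≤ ‖toEmp n y‖ + (|r| + 1) := by
    have := norm_add_le (w.1 - toEmp n y) (toEmp n y)
    rw [sub_add_cancel] at this
    linarith
  have h4 : ‖w.2‖ ≤ ∑ a, ‖w.2 a‖ := (pi_norm_le_iff_of_nonneg hs).mpr fun a =>
    Finset.single_le_sum (f := fun a => ‖w.2 a‖) (fun _ _ => norm_nonneg _) (Finset.mem_univ a)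
  rw [mem_closedBall_zero_iff, Prod.norm_def]
  have : 0 ≤ |r| / (2 * τ) := by positivity
  have : 0 ≤ ‖toEmp n y‖ + (|r| + 1) := by positivity
  exact max_le (by linarith) (by linarith)

/-- The one-step inequality for the inexact accelerated algorithm. -/
theorem IsInexactFISTA.objective_sub_le (hX : closure X = closure (interior X))
    (hk : IsCkOn 2 (X ×ˢ X) (kerExt (X := X) H)) {x : Fin n → X} {y : Fin n → ℝ}
    {τ ν σ η : ℝ} (hτ : 0 < τ) (hν : 0 ≤ ν) (hσ_pos : 0 < σ)
    (hσ : ‖(sampling H x).adjoint ∘L sampling H x‖ + τ * ν ≤ σ)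
    {ε s : ℕ → ℝ} {ft f : ℕ → H} {vbar : ℕ → EmpGrad n d}
    (hf : IsInexactFISTA x y τ ν σ η ε s ft f vbar) {t : ℕ} (ht : 2 ≤ t) (u : H) :
    objective x y τ ν (f t) - objective x y τ ν u ≤
      σ * (‖ft t - u‖ ^ 2 - ‖f t - u‖ ^ 2) + σ * ε t ^ 2 := by
  have hv : vbar t ∈ prodBall n d (τ / σ) := by
    obtain ⟨v0, q, hq, h⟩ := hf.inner_iter t ht
    rw [h]
    exact innerIter_mem_prodBall x (by positivity) η _ v0 hq
  have hgap := hf.inner_stop t ht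
  rw [penalty_eq_sum_norm hX hk] at hgap
  have hu := inner_adjoint_empGrad_le x hv u
  -- The approximate subgradient inequality: `σ` times the stopping rule plus `2σ` times the
  -- feasibility bound `hu`.
  have hsub : 2 * τ * ∑ a, ‖empDeriv H x a (f t)‖ +
      2 * σ * inner ℝ ((empGrad H x).adjoint (vbar t)) (u - f t) - σ * ε t ^ 2 ≤
      2 * τ * ∑ a, ‖empDeriv H x a u‖ := by
    have e1 : 2 * τ * ∑ a, ‖empDeriv H x a (f t)‖ =
        σ * (2 * τ / σ * ∑ a, ‖empDeriv H x a (f t)‖) := by field_simp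
    have e2 : 2 * τ * ∑ a, ‖empDeriv H x a u‖ =
        2 * (σ * (τ / σ * ∑ a, ‖empDeriv H x a u‖)) := by field_simp
    rw [inner_sub_right, e1, e2]
    have m1 := mul_le_mul_of_nonneg_left hgap hσ_pos.le
    have m2 := mul_le_mul_of_nonneg_left hu hσ_pos.le
    linarith
  have key := forwardBackward_le (S := sampling H x) (y := toEmp n y) (h := ft t)
    (mul_nonneg hτ.le hν) hσ_pos hσ (J := fun f => 2 * τ * ∑ a, ‖empDeriv H x a f‖)
    (hf.f_step t ht) hsub
  rw [objective_eq hX hk, objective_eq hX hk]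
  linarith

end Objective

end DerivReg

end

/-! ### The convergence theorem -/

theorem theorem1 {d n : ℕ} {X : Set (EuclideanSpace ℝ (Fin d))}
    (hX : closure X = closure (interior X))
    (H : Type*) [NormedAddCommGroup H] [InnerProductSpace ℝ H] [CompleteSpace H] [RKHS ℝ H X ℝ]
    (hk : DerivReg.IsCkOn 2 (X ×ˢ X) (DerivReg.kerExt (X := X) H))
    (x : Fin n → X) (y : Fin n → ℝ)
    (τ ν σ η : ℝ) (hτ : 0 < τ) (hν : 0 ≤ ν) (hσ_pos : 0 < σ) (hη_pos : 0 < η)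
    (hσ : ‖(DerivReg.sampling H x).adjoint ∘L DerivReg.sampling H x‖ + τ * ν ≤ σ)
    (hη : ‖DerivReg.empGrad H x ∘L (DerivReg.empGrad H x).adjoint‖ ≤ η)
    (l : ℝ) (hl : 3 / 2 < l) (ε : ℕ → ℝ)
    (hε : ε =O[atTop] fun t : ℕ => (t : ℝ) ^ (-l))
    (s : ℕ → ℝ) (ft f : ℕ → H) (vbar : ℕ → DerivReg.EmpGrad n d)
    (hf : DerivReg.IsInexactFISTA x y τ ν σ η ε s ft f vbar) :
    (∃ fz : H, IsMinOn (DerivReg.objective x y τ ν) Set.univ fz) ∧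
    ∃ C : ℝ, 0 < C ∧ ∀ fz : H, IsMinOn (DerivReg.objective x y τ ν) Set.univ fz →
      ∀ t : ℕ, 1 ≤ t →
        DerivReg.objective x y τ ν (f t) - DerivReg.objective x y τ ν fz ≤ C / (t : ℝ) ^ 2 ∧
        (0 < ν → ‖f t - fz‖ ≤ 2 / (t : ℝ) * Real.sqrt (C / (ν * τ))) := by
  have hG := DerivReg.convexOn_dataFit_add_penalty (H := H) x (DerivReg.toEmp n y) hτ.le
  have heq : (DerivReg.objective x y τ ν : H → ℝ) = _ :=
    funext (DerivReg.objective_eq hX hk x y τ ν)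
  have hE : ConvexOn ℝ Set.univ (DerivReg.objective x y τ ν : H → ℝ) := by
    rw [heq]
    exact hG.add ((convexOn_univ_norm.pow (fun _ _ => norm_nonneg _) 2).smul
      (mul_nonneg hτ.le hν))
  obtain ⟨f0, hf0⟩ := DerivReg.exists_isMinOn_objective (H := H) hX hk x y hτ hν
  obtain ⟨C, hC, hrate⟩ := DerivReg.accelerated_rate hE hσ_pos hf.s_one hf.s_step hf.ft_step
    (fun t ht u => hf.objective_sub_le hX hk hτ hν hσ_pos hσ ht u)
    (DerivReg.summable_momentum_sq_mul_error hf.s_one hf.s_step hl hε) f0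
  refine ⟨⟨f0, hf0⟩, C, hC, fun fz hfz t ht => ?_⟩
  -- `C` was built from `f0` only; it serves every minimizer because all share the same value.
  have hval : DerivReg.objective x y τ ν fz = DerivReg.objective x y τ ν f0 :=
    le_antisymm (hfz (Set.mem_univ f0)) (hf0 (Set.mem_univ fz))
  have hle : DerivReg.objective x y τ ν (f t) - DerivReg.objective x y τ ν fz ≤ C / (t : ℝ) ^ 2 :=
    hval ▸ hrate t ht
  refine ⟨hle, fun hνpos => ?_⟩
  have hgrow := DerivReg.quadratic_growth hG (heq ▸ hfz) (f t)
  rw [← DerivReg.objective_eq hX hk, ← DerivReg.objective_eq hX hk] at hgrow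
  have ht0 : (0 : ℝ) < t := by exact_mod_cast ht
  refine le_of_sq_le_sq ?_ (by positivity)
  rw [mul_pow, div_pow, Real.sq_sqrt (by positivity)]
  have h1 : τ * ν / 2 * ‖f t - fz‖ ^ 2 ≤ C / (t : ℝ) ^ 2 := hgrow.trans hle
  have h2 : ‖f t - fz‖ ^ 2 ≤ 2 * (C / (t : ℝ) ^ 2) / (τ * ν) := by
    rw [le_div_iff₀ (by positivity)]
    linarith
  refine h2.trans ?_
  -- The claimed squared bound is twice the one just obtained, so there is room to spare.
  have h3 : 2 ^ 2 / (t : ℝ) ^ 2 * (C / (ν * τ)) = 2 * (2 * (C / (t : ℝ) ^ 2) / (τ * ν)) := by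
    field_simp
  rw [h3]
  have : 0 ≤ 2 * (C / (t : ℝ) ^ 2) / (τ * ν) := by positivity
  linarith
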